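/- Let $B>0$, $B\neq 1$, and $k>0$ be real numbers. There is a constant $c>0$, depending only on $B$ and $k$, with the following property. Let $\Omega\subset\mathbb R^d$ be a compact set (for any $d$), let $\mu$ be a Borel probability measure on $\Omega$, and let $X_N$ be an $N$-dimensional linear subspace, $N\ge 1$, of the space $\mathcal C(\Omega)$ of continuous (real- or complex-valued) functions on $\Omega$. Write $\|f\|_\infty=\max_{x\in\Omega}|f(x)|$ and $\|f\|_q=\left(\int_\Omega|f|^q\,d\mu\right)^{1/q}$. Suppose that $$\|f\|_\infty\le B N^{k/q}\,\|f\|_q\qquad\text{for all } f\in X_N \text{ and all } q\in[2,\infty).$$ Then for every integer $m\ge 1$ with $$m\ \ge\ \frac{c}{[\log B]^2}\,N^{k+2}\,[\log N]^2$$ there are $m$ points $\xi^1,\dots,\xi^m\in\Omega$ (not necessarily distinct) such that $$\|f\|_\infty\le 2B^{k+1}\max_{1\le j\le m}|f(\xi^j)|\qquad\text{for all } f\in X_N.$$ -/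

import Mathlib

open MeasureTheory

/-- The norm `‖f‖_q = (∫ |f|^q dμ)^{1/q}` of a continuous function, for a real exponent `q`. -/
noncomputable def lqNorm {Ω 𝕜 : Type*} [TopologicalSpace Ω] [MeasurableSpace Ω] [RCLike 𝕜]
    (μ : Measure Ω) (q : ℝ) (f : C(Ω, 𝕜)) : ℝ :=
  (∫ x, ‖f x‖ ^ q ∂μ) ^ (1 / q)

/-- The Nikol'skii inequality `X ∈ NI(q,∞)H`: `‖f‖_∞ ≤ H ‖f‖_q` for all `f ∈ X`.
The norm on `C(Ω, 𝕜)`, `Ω` compact, is the uniform norm. -/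
def NikolskiiInfty {Ω 𝕜 : Type*} [TopologicalSpace Ω] [CompactSpace Ω] [MeasurableSpace Ω]
    [RCLike 𝕜] (μ : Measure Ω) (X : Submodule 𝕜 C(Ω, 𝕜)) (q H : ℝ) : Prop :=
  ∀ f ∈ X, ‖f‖ ≤ H * lqNorm μ q f

/-! One exponent `q` suffices. Taking `q = 2 + log N / log B` gives `B ^ q = B ^ 2 * N`, so the
Nikol'skii constant is at most `K = B ^ (k + 1)`, while `K ^ q = K ^ 2 * N ^ (k + 1)` stays
polynomial in `N`. By `sub_le_measureReal_norm_ge`, each `f` of norm 1 is then at least `2 / (3K)`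
on a set of measure at least a multiple of `N ^ (-(k + 1))`. A net of the unit sphere has `exp
(O(N))` elements, so on the order of `N ^ (k + 2)` random points hit all these sets at once
(`exists_points_hitting`), and approximation by the net passes from its elements to all of `X`. -/

open Metric Module in
/-- A volume bound for the cardinality of an `ε`-separated subset of the unit ball. -/
theorem card_le_of_separated_unitBall {E : Type*} [NormedAddCommGroup E] [NormedSpace ℝ E]
    [FiniteDimensional ℝ E] {ε : ℝ} (hε : 0 < ε) (s : Finset E) (hs : ∀ c ∈ s, ‖c‖ ≤ 1)
    (h : ∀ c ∈ s, ∀ d ∈ s, c ≠ d → ε ≤ ‖c - d‖) :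
    (s.card : ℝ) ≤ (1 + 2 / ε) ^ finrank ℝ E := by
  borelize E
  let μ : Measure E := Measure.addHaar
  have hδ : 0 < ε / 2 := by positivity
  have hρ : 0 < 1 + ε / 2 := by positivity
  have D : Set.Pairwise (s : Set E) (Function.onFun Disjoint fun c => ball (c : E) (ε / 2)) := by
    rintro c hc d hd hcd
    apply ball_disjoint_ball
    rw [dist_eq_norm]
    linarith [h c hc d hd hcd]
  have hsub : (⋃ c ∈ s, ball (c : E) (ε / 2)) ⊆ ball (0 : E) (1 + ε / 2) := by
    refine Set.iUnion₂_subset fun x hx => ball_subset_ball' ?_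
    rw [dist_zero_right]
    linarith [hs x hx]
  have I : (s.card : ENNReal) * ENNReal.ofReal ((ε / 2) ^ finrank ℝ E) * μ (ball 0 1) ≤
      ENNReal.ofReal ((1 + ε / 2) ^ finrank ℝ E) * μ (ball 0 1) :=
    calc
      _ = μ (⋃ c ∈ s, ball (c : E) (ε / 2)) := by
        rw [measure_biUnion_finset D fun c _ => measurableSet_ball]
        simp only [μ.addHaar_ball_of_pos _ hδ, Finset.sum_const, nsmul_eq_mul, mul_assoc]
      _ ≤ μ (ball (0 : E) (1 + ε / 2)) := measure_mono hsub
      _ = _ := by simp only [μ.addHaar_ball_of_pos _ hρ]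
  have J : (s.card : ENNReal) * ENNReal.ofReal ((ε / 2) ^ finrank ℝ E) ≤
      ENNReal.ofReal ((1 + ε / 2) ^ finrank ℝ E) :=
    (ENNReal.mul_le_mul_iff_left (measure_ball_pos _ _ zero_lt_one).ne' measure_ball_lt_top.ne).1 I
  have K := ENNReal.toReal_le_of_le_ofReal (pow_nonneg hρ.le _) J
  rw [ENNReal.toReal_mul, ENNReal.toReal_ofReal (by positivity), ENNReal.toReal_natCast,
    ← le_div_iff₀ (by positivity), ← div_pow] at K
  refine K.trans_eq ?_
  congr 1
  field_simp
  ring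

/-- The unit sphere has a finite `ε`-net with at most `(1 + 2 / ε) ^ dim E` elements. -/
theorem exists_net_unitSphere (E : Type*) [NormedAddCommGroup E] [NormedSpace ℝ E]
    [FiniteDimensional ℝ E] {ε : ℝ} (hε : 0 < ε) :
    ∃ s : Finset E, (∀ c ∈ s, ‖c‖ = 1) ∧ (∀ x : E, ‖x‖ = 1 → ∃ c ∈ s, ‖x - c‖ < ε) ∧
      (s.card : ℝ) ≤ (1 + 2 / ε) ^ Module.finrank ℝ E := by
  classical
  by_contra! hcon
  -- By the volume bound, a separated set is too small to violate the claim, so it is not a net and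
  -- can be enlarged, without end.
  have key : ∀ n : ℕ, ∃ s : Finset E, s.card = n ∧ (∀ c ∈ s, ‖c‖ = 1) ∧
      ∀ c ∈ s, ∀ d ∈ s, c ≠ d → ε ≤ ‖c - d‖ := by
    intro n
    induction n with
    | zero => exact ⟨∅, by simp⟩
    | succ n ih =>
      obtain ⟨s, hn, hs, hsep⟩ := ih
      have hcard := card_le_of_separated_unitBall hε s (fun c hc => (hs c hc).le) hsep
      have : ∃ x : E, ‖x‖ = 1 ∧ ∀ c ∈ s, ε ≤ ‖x - c‖ := by
        by_contra! hx
        exact absurd hcard (hcon s hs hx).not_ge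
      obtain ⟨x, hx, hxs⟩ := this
      have hxn : x ∉ s := fun hmem => by
        have := hxs x hmem
        simp at this
        linarith
      refine ⟨insert x s, by rw [Finset.card_insert_of_notMem hxn, hn], ?_, ?_⟩
      · simpa [hx] using hs
      · intro c hc d hd hcd
        rcases Finset.mem_insert.1 hc with rfl | hc' <;>
          rcases Finset.mem_insert.1 hd with rfl | hd'
        · exact absurd rfl hcd
        · exact hxs d hd'
        · rw [norm_sub_rev]; exact hxs c hc'
        · exact hsep c hc' d hd' hcd
  obtain ⟨n, hn⟩ := exists_nat_gt ((1 + 2 / ε) ^ Module.finrank ℝ E)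
  obtain ⟨s, rfl, hs, hsep⟩ := key n
  exact absurd (card_le_of_separated_unitBall hε s (fun c hc => (hs c hc).le) hsep) hn.not_ge

/-- Union bound: `m` independent random points hit each of finitely many sets of measure at
least `p` with positive probability, as soon as `card s * (1 - p) ^ m < 1`. -/
theorem exists_points_hitting {α ι : Type*} [MeasurableSpace α] (μ : Measure α)
    [IsProbabilityMeasure μ] (s : Finset ι) (A : ι → Set α) (hA : ∀ i, MeasurableSet (A i))
    {p : ℝ} (hp : ∀ i ∈ s, p ≤ μ.real (A i)) {m : ℕ} (h : s.card * (1 - p) ^ m < 1) :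
    ∃ ξ : Fin m → α, ∀ i ∈ s, ∃ j, ξ j ∈ A i := by
  by_contra! hcon
  let P : Measure (Fin m → α) := Measure.pi fun _ => μ
  have hcover : (Set.univ : Set (Fin m → α)) ⊆ ⋃ i ∈ s, Set.pi Set.univ fun _ => (A i)ᶜ := by
    intro ξ _
    obtain ⟨i, hi, hξ⟩ := hcon ξ
    simp only [Set.mem_iUnion]
    exact ⟨i, hi, fun j _ => hξ j⟩
  have h1 : (1 : ℝ) ≤ ∑ i ∈ s, P.real (Set.pi Set.univ fun _ => (A i)ᶜ) :=
    calc
      (1 : ℝ) = P.real Set.univ := by simp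
      _ ≤ P.real (⋃ i ∈ s, Set.pi Set.univ fun _ => (A i)ᶜ) := measureReal_mono hcover (measure_ne_top P _)
      _ ≤ _ := measureReal_biUnion_finset_le _ _
  have h2 : ∀ i ∈ s, P.real (Set.pi Set.univ fun _ => (A i)ᶜ) ≤ (1 - p) ^ m := by
    intro i hi
    have : P.real (Set.pi Set.univ fun _ => (A i)ᶜ) = (μ.real (A i)ᶜ) ^ m := by
      simp [P, measureReal_def, Measure.pi_pi]
    rw [this, probReal_compl_eq_one_sub (hA i)]
    exact pow_le_pow_left₀ (by linarith [measureReal_le_one (μ := μ) (s := A i)])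
      (by linarith [hp i hi]) m
  have h3 := Finset.sum_le_sum h2
  rw [Finset.sum_const, nsmul_eq_mul] at h3
  linarith

/-- All elements are multiples of one function, hence share a maximum point of the modulus. -/
theorem exists_point_norm_le_of_finrank_eq_one {Ω 𝕜 : Type*} [TopologicalSpace Ω] [CompactSpace Ω]
    [RCLike 𝕜] [Nonempty Ω] {X : Submodule 𝕜 C(Ω, 𝕜)} (hX : Module.finrank 𝕜 X = 1) :
    ∃ x : Ω, ∀ f ∈ X, ‖f‖ ≤ ‖f x‖ := by
  obtain ⟨g, -, hg⟩ := finrank_eq_one_iff'.1 hX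
  obtain ⟨x, -, hx⟩ := isCompact_univ.exists_isMaxOn Set.univ_nonempty
    (map_continuous (g : C(Ω, 𝕜))).norm.continuousOn
  refine ⟨x, fun f hf => (ContinuousMap.norm_le _ (norm_nonneg _)).2 fun y => ?_⟩
  obtain ⟨a, ha⟩ := hg ⟨f, hf⟩
  obtain rfl : a • (g : C(Ω, 𝕜)) = f := congrArg Subtype.val ha
  simp only [ContinuousMap.smul_apply, norm_smul]
  exact mul_le_mul_of_nonneg_left (hx (Set.mem_univ y)) (norm_nonneg a)

section

variable {Ω 𝕜 : Type*} [TopologicalSpace Ω] [CompactSpace Ω] [MeasurableSpace Ω] [BorelSpace Ω]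
  [RCLike 𝕜] {μ : Measure Ω} [IsProbabilityMeasure μ]

theorem integrable_norm_rpow (f : C(Ω, 𝕜)) {q : ℝ} (hq : 0 ≤ q) :
    Integrable (fun x => ‖f x‖ ^ q) μ := by
  have hc : Continuous fun x => ‖f x‖ ^ q :=
    (map_continuous f).norm.rpow_const fun _ => Or.inr hq
  refine Integrable.of_bound hc.measurable.aestronglyMeasurable (‖f‖ ^ q)
    (Filter.Eventually.of_forall fun x => ?_)
  rw [Real.norm_of_nonneg (by positivity)]
  exact Real.rpow_le_rpow (norm_nonneg _) (f.norm_coe_le_norm x) hq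

theorem lqNorm_le_norm (f : C(Ω, 𝕜)) {q : ℝ} (hq : 0 < q) : lqNorm μ q f ≤ ‖f‖ := by
  have h : ∫ x, ‖f x‖ ^ q ∂μ ≤ ‖f‖ ^ q := by
    refine (integral_mono (integrable_norm_rpow f hq.le) (integrable_const (‖f‖ ^ q))
      fun x => Real.rpow_le_rpow (norm_nonneg _) (f.norm_coe_le_norm x) hq.le).trans_eq ?_
    simp
  calc
    lqNorm μ q f ≤ (‖f‖ ^ q) ^ (1 / q) :=
      Real.rpow_le_rpow (integral_nonneg fun x => by positivity) h (by positivity)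
    _ = ‖f‖ := by rw [one_div, Real.rpow_rpow_inv (norm_nonneg _) hq.ne']

/-- A lower bound for the measure of the set where a normalized function is large. -/
theorem sub_le_measureReal_norm_ge (f : C(Ω, 𝕜)) (hf : ‖f‖ = 1) {q K t : ℝ} (hq : 0 < q)
    (hK : 0 < K) (ht : 0 ≤ t) (h : ‖f‖ ≤ K * lqNorm μ q f) :
    K⁻¹ ^ q - t ^ q ≤ μ.real {x | t ≤ ‖f x‖} := by
  have hmeas : MeasurableSet {x | t ≤ ‖f x‖} :=
    (isClosed_le continuous_const (map_continuous f).norm).measurableSet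
  have hint : 0 ≤ ∫ x, ‖f x‖ ^ q ∂μ := integral_nonneg fun x => by positivity
  have h1 : K⁻¹ ^ q ≤ ∫ x, ‖f x‖ ^ q ∂μ := by
    have : K⁻¹ ≤ lqNorm μ q f := by
      rw [inv_le_iff_one_le_mul₀' hK, ← hf]; exact h
    refine (Real.rpow_le_rpow (by positivity) this hq.le).trans_eq ?_
    rw [lqNorm, one_div, Real.rpow_inv_rpow hint hq.ne']
  -- Integrate the pointwise bound of `|f| ^ q` by `t ^ q` plus the indicator of `{t ≤ |f|}`, valid
  -- as `|f| ≤ 1`.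
  have h2 : ∫ x, ‖f x‖ ^ q ∂μ ≤ t ^ q + μ.real {x | t ≤ ‖f x‖} := by
    have hi : Integrable (Set.indicator {x | t ≤ ‖f x‖} fun _ => (1 : ℝ)) μ :=
      (integrable_const 1).indicator hmeas
    have := integral_mono (integrable_norm_rpow (μ := μ) f hq.le)
      ((integrable_const (t ^ q)).add hi) fun x => ?_
    · refine this.trans_eq ?_
      simp only [Pi.add_apply]
      rw [integral_add (integrable_const _) hi, integral_indicator_const _ hmeas]
      simp
    · simp only [Pi.add_apply]
      by_cases hx : t ≤ ‖f x‖
      · rw [Set.indicator_of_mem (show x ∈ {x | t ≤ ‖f x‖} from hx)]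
        have : ‖f x‖ ^ q ≤ 1 :=
          Real.rpow_le_one (norm_nonneg _) (hf ▸ f.norm_coe_le_norm x) hq.le
        linarith [Real.rpow_nonneg ht q]
      · rw [Set.indicator_of_notMem (show x ∉ {x | t ≤ ‖f x‖} from hx), add_zero]
        exact Real.rpow_le_rpow (norm_nonneg _) (not_le.1 hx).le hq.le
  linarith

/-- If a nonzero space satisfies the Nikol'skii inequalities with constants `B * M ^ (k / q)` for
all `q ≥ 2`, then `1 ≤ B`. -/
theorem one_le_of_nikolskiiInfty {X : Submodule 𝕜 C(Ω, 𝕜)} (hX : X ≠ ⊥) {B k M : ℝ} (hB : 0 < B)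
    (hM : 0 < M) (h : ∀ q : ℝ, 2 ≤ q → NikolskiiInfty μ X q (B * M ^ (k / q))) : 1 ≤ B := by
  obtain ⟨f, hfX, hf⟩ := X.ne_bot_iff.1 hX
  have hf' : 0 < ‖f‖ := norm_pos_iff.2 hf
  -- Every constant is at least 1 because `‖f‖_q ≤ ‖f‖_∞`; let `q → ∞`.
  have hlim : Filter.Tendsto (fun q : ℝ => B * M ^ (k / q)) Filter.atTop (nhds (B * M ^ (0 : ℝ))) :=
    ((Real.continuousAt_const_rpow hM.ne').tendsto.comp
      (Filter.Tendsto.const_div_atTop Filter.tendsto_id k)).const_mul B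
  rw [Real.rpow_zero, mul_one] at hlim
  refine ge_of_tendsto hlim ?_
  filter_upwards [Filter.eventually_ge_atTop (2 : ℝ)] with q hq
  have hpos : 0 < B * M ^ (k / q) := by positivity
  have := (h q hq f hfX).trans
    (mul_le_mul_of_nonneg_left (lqNorm_le_norm (μ := μ) f (by linarith)) hpos.le)
  exact le_of_mul_le_mul_right (by linarith) hf'

/-- Sampling discretization of the uniform norm from a single Nikol'skii inequality. -/
theorem exists_points_norm_le {X : Submodule 𝕜 C(Ω, 𝕜)} [FiniteDimensional 𝕜 X] {q K p : ℝ}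
    (hq : 2 ≤ q) (hK : 0 < K) (hX : NikolskiiInfty μ X q K) (hp : p ≤ 5 / 9 * K⁻¹ ^ q) {m : ℕ}
    (hm : 2 * Module.finrank 𝕜 X * Real.log (1 + 12 * K) < m * p) :
    ∃ ξ : Fin m → Ω, ∀ f ∈ X, ‖f‖ ≤ 2 * K * ⨆ j : Fin m, ‖f (ξ j)‖ := by
  have : FiniteDimensional ℝ X := FiniteDimensional.trans ℝ 𝕜 X
  have hdim : Module.finrank ℝ X ≤ 2 * Module.finrank 𝕜 X := by
    rw [← Module.finrank_mul_finrank ℝ 𝕜 X]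
    exact Nat.mul_le_mul_right _ (RCLike.finrank_le_two 𝕜)
  -- The radius is chosen so that `2 / (3K) - 1 / (6K) = 1 / (2K)`, the source of the factor `2K`.
  obtain ⟨s, hs1, hs2, hs3⟩ := exists_net_unitSphere X (ε := 1 / (6 * K)) (by positivity)
  have hbase : 1 + 2 / (1 / (6 * K)) = 1 + 12 * K := by field_simp; ring
  have hone : 1 ≤ 1 + 12 * K := by linarith
  have hcard : (s.card : ℝ) ≤ Real.exp (2 * Module.finrank 𝕜 X * Real.log (1 + 12 * K)) := by
    rw [hbase] at hs3
    refine (hs3.trans (pow_le_pow_right₀ hone hdim)).trans_eq ?_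
    rw [← Real.rpow_natCast, Real.rpow_def_of_pos (by linarith)]
    push_cast
    ring_nf
  have hq0 : 0 < q := by linarith
  have htail : ∀ f ∈ s, p ≤ μ.real {x | 2 / (3 * K) ≤ ‖(f : C(Ω, 𝕜)) x‖} := by
    intro f hf
    refine le_trans ?_ (sub_le_measureReal_norm_ge (f : C(Ω, 𝕜)) (hs1 f hf) hq0 hK
      (by positivity) (hX f f.2))
    have h1 : (2 / (3 * K)) ^ q = (2 / 3 : ℝ) ^ q * K⁻¹ ^ q := by
      rw [← Real.mul_rpow (by norm_num) (by positivity)]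
      congr 1
      field_simp
    have h2 : (2 / 3 : ℝ) ^ q ≤ 4 / 9 := by
      refine (Real.rpow_le_rpow_of_exponent_ge (by norm_num) (by norm_num) hq).trans_eq ?_
      norm_num
    have h3 : 0 ≤ K⁻¹ ^ q := by positivity
    rw [h1]
    nlinarith
  have hprob : s.card * (1 - p) ^ m < 1 := by
    rcases s.eq_empty_or_nonempty with rfl | ⟨f, hf⟩
    · simp
    have hp1 : 0 ≤ 1 - p := by linarith [(htail f hf).trans measureReal_le_one]
    have h1 : (1 - p) ^ m ≤ Real.exp (-(m * p)) := by
      refine (pow_le_pow_left₀ hp1 (Real.one_sub_le_exp_neg p) m).trans_eq ?_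
      rw [← Real.exp_nat_mul]
      ring_nf
    calc
      s.card * (1 - p) ^ m
        ≤ Real.exp (2 * Module.finrank 𝕜 X * Real.log (1 + 12 * K)) * Real.exp (-(m * p)) :=
          mul_le_mul hcard h1 (by positivity) (by positivity)
      _ < 1 := by
          rw [← Real.exp_add, Real.exp_lt_one_iff]
          linarith
  obtain ⟨ξ, hξ⟩ := exists_points_hitting μ s (fun f => {x | 2 / (3 * K) ≤ ‖(f : C(Ω, 𝕜)) x‖})
    (fun f => (isClosed_le continuous_const
      (map_continuous (f : C(Ω, 𝕜))).norm).measurableSet) htail hprob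
  refine ⟨ξ, fun f hf => ?_⟩
  rcases eq_or_ne f 0 with rfl | hf0
  · simp
  have hfn : 0 < ‖f‖ := norm_pos_iff.2 hf0
  obtain ⟨g, hgs, hg⟩ := hs2 (((‖f‖⁻¹ : ℝ) : 𝕜) • (⟨f, hf⟩ : X)) (by
    rw [norm_smul, RCLike.norm_ofReal, abs_of_pos (by positivity)]
    exact inv_mul_cancel₀ hfn.ne')
  obtain ⟨j, hj⟩ := hξ g hgs
  have hpt : ‖((‖f‖⁻¹ : ℝ) : 𝕜) * f (ξ j) - (g : C(Ω, 𝕜)) (ξ j)‖ ≤ 1 / (6 * K) :=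
    (ContinuousMap.norm_coe_le_norm
      (((((‖f‖⁻¹ : ℝ) : 𝕜) • (⟨f, hf⟩ : X) - g : X)) : C(Ω, 𝕜)) (ξ j)).trans hg.le
  have hj' : 2 / (3 * K) ≤ ‖(g : C(Ω, 𝕜)) (ξ j)‖ := hj
  have htri := norm_sub_norm_le ((g : C(Ω, 𝕜)) (ξ j)) (((‖f‖⁻¹ : ℝ) : 𝕜) * f (ξ j))
  rw [norm_sub_rev, norm_mul, RCLike.norm_ofReal, abs_of_pos (by positivity)] at htri
  have hlow : 1 / (2 * K) ≤ ‖f‖⁻¹ * ‖f (ξ j)‖ := by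
    have : 2 / (3 * K) - 1 / (6 * K) = 1 / (2 * K) := by field_simp; norm_num
    linarith
  have hsup : ‖f (ξ j)‖ ≤ ⨆ j : Fin m, ‖f (ξ j)‖ :=
    le_ciSup (f := fun j => ‖f (ξ j)‖) (Set.finite_range _).bddAbove j
  calc
    ‖f‖ = 2 * K * (1 / (2 * K) * ‖f‖) := by field_simp
    _ ≤ 2 * K * (‖f‖⁻¹ * ‖f (ξ j)‖ * ‖f‖) := by gcongr
    _ = 2 * K * ‖f (ξ j)‖ := by field_simp
    _ ≤ 2 * K * ⨆ j : Fin m, ‖f (ξ j)‖ := by gcongr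

end

theorem mainTheorem4 (B k : ℝ) (hB : 0 < B) (hB1 : B ≠ 1) (hk : 0 < k) :
    ∃ c : ℝ, 0 < c ∧
      ∀ (𝕜 : Type*) [RCLike 𝕜] (d : ℕ) (Ω : Set (EuclideanSpace ℝ (Fin d))) [CompactSpace Ω]
        (μ : Measure Ω) [IsProbabilityMeasure μ] (N : ℕ) (X : Submodule 𝕜 C(Ω, 𝕜)),
        1 ≤ N → Module.finrank 𝕜 X = N →
        (∀ q : ℝ, 2 ≤ q → NikolskiiInfty μ X q (B * (N : ℝ) ^ (k / q))) →
        ∀ m : ℕ, 1 ≤ m →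
          c / Real.log B ^ 2 * (N : ℝ) ^ (k + 2) * Real.log (N : ℝ) ^ 2 ≤ (m : ℝ) →
          ∃ ξ : Fin m → Ω, ∀ f ∈ X,
            ‖f‖ ≤ 2 * B ^ (k + 1) * ⨆ j : Fin m, ‖f (ξ j)‖ := by
  have hlogB : Real.log B ≠ 0 := Real.log_ne_zero_of_pos_of_ne_one hB hB1
  have hlog2 : 0 < Real.log 2 := Real.log_pos one_lt_two
  set K := B ^ (k + 1) with hKdef
  have hK : 0 < K := by positivity
  have hL : 0 < Real.log (1 + 12 * K) := Real.log_pos (by linarith)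
  -- `log B ^ 2` cancels the given denominator; dividing by `log 2 ^ 2` discards `log N ^ 2` when `N
  -- ≥ 2`.
  refine ⟨4 * Real.log (1 + 12 * K) * K ^ 2 * Real.log B ^ 2 / Real.log 2 ^ 2, by positivity, ?_⟩
  intro 𝕜 _ d Ω _ μ _ N X hN hdim hX m hm hmN
  have hXfin : FiniteDimensional 𝕜 X := FiniteDimensional.of_finrank_pos (by omega)
  have hXbot : X ≠ ⊥ := by
    rintro rfl
    simp at hdim
    omega
  have hN0 : (0 : ℝ) < N := by exact_mod_cast hN
  have hB1' : 1 < B := lt_of_le_of_ne (one_le_of_nikolskiiInfty hXbot hB hN0 hX) hB1.symm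
  -- For `N = 1` the bound on `m` is void since `log N = 0`, but one point suffices.
  rcases hN.eq_or_lt with rfl | hN2
  · have : Nonempty Ω := nonempty_of_isProbabilityMeasure μ
    obtain ⟨x, hx⟩ := exists_point_norm_le_of_finrank_eq_one hdim
    refine ⟨fun _ => x, fun f hf => ?_⟩
    have : Nonempty (Fin m) := ⟨⟨0, hm⟩⟩
    rw [ciSup_const]
    have hK1 : 1 ≤ K := Real.one_le_rpow hB1'.le (by linarith)
    nlinarith [hx f hf, norm_nonneg (f x)]
  have hlogB' : 0 < Real.log B := Real.log_pos hB1'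
  have hN2' : (2 : ℝ) ≤ N := by exact_mod_cast hN2
  have hlogN : Real.log 2 ≤ Real.log N := Real.log_le_log two_pos hN2'
  set q : ℝ := 2 + Real.log N / Real.log B with hqdef
  have hq : 2 ≤ q := by
    have : 0 ≤ Real.log N / Real.log B := div_nonneg (by linarith) hlogB'.le
    linarith
  have hBq : (B : ℝ) ^ q = B ^ 2 * N := by
    rw [hqdef, Real.rpow_add hB, Real.rpow_two, Real.rpow_def_of_pos hB (_ / _),
      mul_div_cancel₀ _ hlogB, Real.exp_log hN0]
  have hNq : (N : ℝ) ^ (k / q) ≤ B ^ k := by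
    have h1 : (N : ℝ) ≤ B ^ q := by rw [hBq]; exact le_mul_of_one_le_left hN0.le (one_le_pow₀ hB1'.le)
    refine (Real.rpow_le_rpow hN0.le h1 (by positivity)).trans_eq ?_
    rw [← Real.rpow_mul hB.le, mul_div_cancel₀ _ (by linarith)]
  have hNik : NikolskiiInfty μ X q K := by
    intro f hf
    refine (hX q hq f hf).trans ?_
    have h0 : 0 ≤ lqNorm μ q f :=
      Real.rpow_nonneg (integral_nonneg fun x => by positivity) _
    refine mul_le_mul_of_nonneg_right ?_ h0
    rw [hKdef, Real.rpow_add hB, Real.rpow_one, mul_comm]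
    gcongr
  have hKq : K⁻¹ ^ q = (K ^ 2 * (N : ℝ) ^ (k + 1))⁻¹ := by
    rw [Real.inv_rpow hK.le]
    congr 1
    rw [hKdef, ← Real.rpow_mul hB.le, mul_comm, Real.rpow_mul hB.le, hBq,
      Real.mul_rpow (by positivity) hN0.le, ← Real.rpow_two, ← Real.rpow_mul hB.le, mul_comm 2,
      Real.rpow_mul hB.le, Real.rpow_two]
  refine exists_points_norm_le hq hK hNik le_rfl ?_
  rw [hKq, hdim]
  have hpow : (N : ℝ) ^ (k + 2) = (N : ℝ) ^ (k + 1) * N := by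
    rw [← Real.rpow_add_one hN0.ne']
    ring_nf
  have hsq : Real.log 2 ^ 2 ≤ Real.log N ^ 2 := pow_le_pow_left₀ hlog2.le hlogN 2
  have hmlow : 4 * Real.log (1 + 12 * K) * K ^ 2 * ((N : ℝ) ^ (k + 1) * N) ≤ m := by
    refine le_trans ?_ hmN
    rw [hpow]
    calc
      _ = 4 * Real.log (1 + 12 * K) * K ^ 2 * Real.log B ^ 2 / Real.log 2 ^ 2 / Real.log B ^ 2 *
          ((N : ℝ) ^ (k + 1) * N) * Real.log 2 ^ 2 := by field_simp
      _ ≤ _ := by gcongr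
  -- Strictness comes from `2 < 4 * (5 / 9)`.
  calc
    2 * (N : ℝ) * Real.log (1 + 12 * K)
      < 4 * Real.log (1 + 12 * K) * N * (5 / 9) := by nlinarith [mul_pos hL hN0]
    _ = 4 * Real.log (1 + 12 * K) * K ^ 2 * ((N : ℝ) ^ (k + 1) * N) *
          (5 / 9 * (K ^ 2 * (N : ℝ) ^ (k + 1))⁻¹) := by field_simp
    _ ≤ _ := by gcongr
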